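/- Definitions. Let $P_n,Q_n$ ($n\ge1$) be probability measures on measurable spaces $(\mathcal X_n,\mathcal A_n)$. The sequences $(P_n)$ and $(Q_n)$ are asymptotically equivalent if $P_n(A_n)-Q_n(A_n)\to0$ for every sequence of sets $A_n\in\mathcal A_n$; $(P_n)$ is contiguous with respect to $(Q_n)$ if, for every sequence of sets $A_n\in\mathcal A_n$ with $Q_n(A_n)\to0$, also $P_n(A_n)\to0$. For sequences of random variables these properties refer to their distributions. For $p,q\in[0,1]$ put $$\rho(p,q)=(\sqrt p-\sqrt q)^2+(\sqrt{1-p}-\sqrt{1-q})^2 .$$ Theorem. For each $n$ let $1\le N(n)\le\infty$ and let $X_n=(I_{n,i})_{i=1}^{N(n)}$ and $X'_n=(I'_{n,i})_{i=1}^{N(n)}$ be finite or countably infinite random vectors, each consisting of independent indicator variables $I_{n,i}\sim\mathrm{Be}(p_{n,i})$ and $I'_{n,i}\sim\mathrm{Be}(p'_{n,i})$, respectively, with arbitrary $p_{n,i},p'_{n,i}\in[0,1]$. The vectors take values in $\{0,1\}^{N(n)}$ with the product $\sigma$-field. Write $q_{n,i}=1-p_{n,i}$, $q'_{n,i}=1-p'_{n,i}$.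 All sums below take values in $[0,\infty]$. (i) $(X_n)$ and $(X'_n)$ are asymptotically equivalent if and only if $\sum_{i=1}^{N(n)}\rho(p_{n,i},p'_{n,i})\to0$ as $n\to\infty$. (ii) $(X_n)$ is contiguous with respect to $(X'_n)$ if and only if both $\sum_{i=1}^{N(n)}\rho(p_{n,i},p'_{n,i})=O(1)$ as $n\to\infty$ (that is, there is a constant $K<\infty$ such that the sum is at most $K$ for all sufficiently large $n$) and $$\lim_{C\to\infty}\limsup_{n\to\infty}\Bigl(\sum_{i:\,p_{n,i}>Cp'_{n,i}}p_{n,i}+\sum_{i:\,q_{n,i}>Cq'_{n,i}}q_{n,i}\Bigr)=0 .$$ -/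

import Mathlib

open MeasureTheory ProbabilityTheory Filter Topology
open scoped ENNReal NNReal unitInterval

/-- Asymptotic equivalence of two sequences of probability measures `P n`, `Q n` on measurable
spaces `𝓧 n`: `P n (A n) - Q n (A n) → 0` for every sequence of measurable sets `A n`. -/
def AsympEquiv {𝓧 : ℕ → Type*} [∀ n, MeasurableSpace (𝓧 n)] (P Q : ∀ n, Measure (𝓧 n)) : Prop :=
  ∀ A : ∀ n, Set (𝓧 n), (∀ n, MeasurableSet (A n)) →
    Tendsto (fun n => (P n).real (A n) - (Q n).real (A n)) atTop (𝓝 0)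

/-- Contiguity of a sequence of probability measures `P n` with respect to `Q n`: for every
sequence of measurable sets `A n` with `Q n (A n) → 0`, also `P n (A n) → 0`. -/
def Contiguous {𝓧 : ℕ → Type*} [∀ n, MeasurableSpace (𝓧 n)] (P Q : ∀ n, Measure (𝓧 n)) : Prop :=
  ∀ A : ∀ n, Set (𝓧 n), (∀ n, MeasurableSet (A n)) →
    Tendsto (fun n => Q n (A n)) atTop (𝓝 0) → Tendsto (fun n => P n (A n)) atTop (𝓝 0)

/-- The index set `{i : 1 ≤ i ≤ N}` for `N ≤ ∞`; it is `{1, 2, …}` when `N = ∞`. -/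
abbrev Idx (N : ℕ∞) : Type := {i : ℕ // 1 ≤ i ∧ (i : ℕ∞) ≤ N}

/-- `X = (X i)` is a vector of independent indicator variables (values in `{0, 1}`) on `(Ω, μ)`,
where `X i` has distribution `Be(p i)`, i.e. it is `1` with probability `p i`. -/
structure IsIndicatorVector {ι Ω : Type*} [MeasurableSpace Ω] (μ : Measure Ω)
    (X : ι → Ω → Fin 2) (p : ι → I) : Prop where
  measurable : ∀ i, Measurable (X i)
  hasLaw : ∀ i, HasLaw (X i) (bernoulliMeasure (1 : Fin 2) 0 (p i)) μ
  indep : iIndepFun X μ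

/-- The distribution of the random vector `(X i)` on `{0, 1}^ι` with the product σ-field. -/
noncomputable def vectorLaw {ι Ω : Type*} [MeasurableSpace Ω] (μ : Measure Ω)
    (X : ι → Ω → Fin 2) : Measure (ι → Fin 2) :=
  μ.map (fun ω i => X i ω)

/-- `ρ(p, q) = (√p - √q)² + (√(1 - p) - √(1 - q))²`. -/
noncomputable def rho (p q : ℝ) : ℝ :=
  (√p - √q) ^ 2 + (√(1 - p) - √(1 - q)) ^ 2

/-- `∑ i, ρ(p i, p' i)`, a sum of nonnegative terms with value in `[0, ∞]`. -/
noncomputable def rhoSum {ι : Type*} (p p' : ι → I) : ℝ≥0∞ :=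
  ∑' i, ENNReal.ofReal (rho (p i) (p' i))

/-- `∑_{i : p i > C p' i} p i`, a sum of nonnegative terms with value in `[0, ∞]`. -/
noncomputable def tailSum {ι : Type*} (C : ℝ) (p p' : ι → I) : ℝ≥0∞ :=
  ∑' i : {i : ι // C * (p' i : ℝ) < (p i : ℝ)}, ENNReal.ofReal (p i.1 : ℝ)

/-!
The law of a vector of independent indicators is the product `bernProd p` of Bernoulli measures.
Everything is read off from the Hellinger affinity, which is multiplicative: on finitely many
coordinates the affinity of the two laws is `∏ (1 - ρ i / 2)`, which lies between
`1 - ∑ ρ i / 2` and `exp (-∑ ρ i / 2)`. All estimates are made on finite-dimensional cylinders,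
where they are inequalities between finite sums. Those bounding one law by the other are linear
in the probabilities and extend to measurable sets by approximation
(`real_le_add_mul_real_of_cylinder`).

Asymptotic equivalence. By Cauchy–Schwarz the total variation is at most `2 √(∑ ρ)`
(`bernProd_real_le_add_sqrt`). Conversely the likelihood-ratio test has total error at most the
affinity, hence at most `exp (-∑ ρ / 2)` (`exists_test_le_exp_neg_sum_rho`), so that a small total
variation forces a small `∑ ρ`.

Contiguity, necessity. Contiguity has a uniform `ε`-`δ` form (`Contiguous.exists_forall_real_le`).
Unbounded `∑ ρ` would make the likelihood-ratio test separate the laws completely. For the tail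
sums, test whether some coordinate with `p i > C p' i` equals `1`: this has probability at most
`∑ p' i ≤ 4 ∑ ρ / C` (for `C ≥ 4`) under the second law and at least `1 - exp (-∑ p i)` under the first
(`tailSum_le_of_forall_real_le`); the same test for the value `0` treats the other tail.

Contiguity, sufficiency. Replacing `p i` by `p' i` at the tail coordinates (`truncParam`) changes
the law by little in total variation, since there `ρ ≤ 2 |p i - p' i|` is bounded by the terms of
the tail sums. After that, likelihood ratios of single coordinates are at most `C`, and the second
moment of the full likelihood ratio is at most `exp ((√C + 1)² ∑ ρ)`
(`bernProd_real_le_of_le_mul`), which bounds the first law by the second uniformly in `n`.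
-/

/-! ### Finite weights: total variation against Hellinger affinity and chi-square -/

section FiniteWeights

variable {κ : Type*} [Fintype κ] {a b : κ → ℝ}

/-- Total variation is controlled by the Hellinger distance: `(a(A) - b(A))² ≤ 8 (1 - ∑ √(a b))`. -/
lemma sq_sum_sub_sum_le_affinity (ha : ∀ x, 0 ≤ a x) (hb : ∀ x, 0 ≤ b x) (ha1 : ∑ x, a x = 1)
    (hb1 : ∑ x, b x = 1) (A : Finset κ) :
    (∑ x ∈ A, a x - ∑ x ∈ A, b x) ^ 2 ≤ 8 * (1 - ∑ x, √(a x) * √(b x)) := by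
  have h1 : ∑ x ∈ A, a x - ∑ x ∈ A, b x = ∑ x ∈ A, (√(a x) - √(b x)) * (√(a x) + √(b x)) := by
    rw [← Finset.sum_sub_distrib]
    refine Finset.sum_congr rfl fun x _ => ?_
    linear_combination -Real.sq_sqrt (ha x) + Real.sq_sqrt (hb x)
  have h2 : ∑ x ∈ A, (√(a x) - √(b x)) ^ 2 ≤ 2 * (1 - ∑ x, √(a x) * √(b x)) := by
    calc _ ≤ ∑ x, (√(a x) - √(b x)) ^ 2 :=
          Finset.sum_le_sum_of_subset_of_nonneg (Finset.subset_univ _) fun _ _ _ => sq_nonneg _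
      _ = ∑ x, (a x + b x - 2 * (√(a x) * √(b x))) := by
          refine Finset.sum_congr rfl fun x _ => ?_
          linear_combination Real.sq_sqrt (ha x) + Real.sq_sqrt (hb x)
      _ = _ := by
          rw [Finset.sum_sub_distrib, Finset.sum_add_distrib, ha1, hb1, ← Finset.mul_sum]; ring
  have h3 : ∑ x ∈ A, (√(a x) + √(b x)) ^ 2 ≤ 4 := by
    calc _ ≤ ∑ x, (√(a x) + √(b x)) ^ 2 :=
          Finset.sum_le_sum_of_subset_of_nonneg (Finset.subset_univ _) fun _ _ _ => sq_nonneg _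
      _ ≤ ∑ x, 2 * (a x + b x) := by
          refine Finset.sum_le_sum fun x _ => ?_
          nlinarith [Real.sq_sqrt (ha x), Real.sq_sqrt (hb x), sq_nonneg (√(a x) - √(b x))]
      _ = 4 := by rw [← Finset.mul_sum, Finset.sum_add_distrib, ha1, hb1]; norm_num
  have h0 : 0 ≤ ∑ x ∈ A, (√(a x) - √(b x)) ^ 2 := Finset.sum_nonneg fun _ _ => sq_nonneg _
  rw [h1]
  refine (Finset.sum_mul_sq_le_sq_mul_sq _ _ _).trans ?_
  nlinarith

/-- The likelihood-ratio test `{b ≤ a}` has total error at most the Hellinger affinity, because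
`min(a, b) ≤ √(a b)`. -/
lemma sum_min_le_affinity (ha : ∀ x, 0 ≤ a x) (hb : ∀ x, 0 ≤ b x) (A : Finset κ) [DecidableEq κ]
    (hA : ∀ x, x ∈ A ↔ b x ≤ a x) :
    ∑ x ∈ A, b x + ∑ x ∈ Aᶜ, a x ≤ ∑ x, √(a x) * √(b x) := by
  rw [← Finset.sum_add_sum_compl A fun x => √(a x) * √(b x)]
  refine add_le_add (Finset.sum_le_sum fun x hx => ?_) (Finset.sum_le_sum fun x hx => ?_)
  · calc b x = √(b x) * √(b x) := (Real.mul_self_sqrt (hb x)).symm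
      _ ≤ _ := by gcongr; exact (hA x).1 hx
  · have : a x ≤ b x := by
      rw [Finset.mem_compl, hA] at hx
      exact (not_le.1 hx).le
    calc a x = √(a x) * √(a x) := (Real.mul_self_sqrt (ha x)).symm
      _ ≤ _ := by gcongr

/-- Cauchy–Schwarz bound of `a(A)` by `b(A)` through the second moment of the likelihood ratio. -/
lemma sq_sum_le_sum_mul_sum_sq_div (hb : ∀ x, 0 ≤ b x) (hab : ∀ x, b x = 0 → a x = 0)
    (A : Finset κ) : (∑ x ∈ A, a x) ^ 2 ≤ (∑ x ∈ A, b x) * ∑ x, a x ^ 2 / b x := by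
  have h1 : ∑ x ∈ A, a x = ∑ x ∈ A, √(b x) * (a x / √(b x)) := by
    refine Finset.sum_congr rfl fun x _ => ?_
    rcases (hb x).eq_or_lt with h | h
    · simp [← h, hab x h.symm]
    · have := Real.sqrt_pos.2 h
      field_simp
  rw [h1]
  refine (Finset.sum_mul_sq_le_sq_mul_sq _ _ _).trans ?_
  simp only [div_pow, Real.sq_sqrt (hb _)]
  refine mul_le_mul_of_nonneg_left ?_ (Finset.sum_nonneg fun x _ => hb x)
  exact Finset.sum_le_sum_of_subset_of_nonneg (Finset.subset_univ _) fun x _ _ =>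
    div_nonneg (sq_nonneg _) (hb x)

end FiniteWeights

/-! ### Bernoulli weights -/

/-- The mass that the Bernoulli distribution `Be(p)` on `{0, 1}` gives to `j`. -/
noncomputable def bernWeight (p : I) (j : Fin 2) : ℝ := if j = 1 then p else 1 - p

@[simp] lemma bernWeight_zero (p : I) : bernWeight p 0 = 1 - p := by simp [bernWeight]

@[simp] lemma bernWeight_one (p : I) : bernWeight p 1 = p := by simp [bernWeight]

lemma bernWeight_nonneg (p : I) (j : Fin 2) : 0 ≤ bernWeight p j := by
  unfold bernWeight
  split_ifs
  exacts [p.2.1, sub_nonneg.2 p.2.2]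

lemma bernWeight_le_one (p : I) (j : Fin 2) : bernWeight p j ≤ 1 := by
  unfold bernWeight
  split_ifs
  exacts [p.2.2, by linarith [p.2.1]]

lemma bernoulliMeasure_real_singleton (p : I) (j : Fin 2) :
    (bernoulliMeasure (1 : Fin 2) 0 p).real {j} = bernWeight p j := by
  classical
  rw [bernoulliMeasure_real_apply p (measurableSet_singleton j)]
  fin_cases j <;> simp

lemma rho_nonneg (p q : ℝ) : 0 ≤ rho p q := by unfold rho; positivity

lemma rho_comm (p q : ℝ) : rho p q = rho q p := by unfold rho; ring

lemma sqrt_bernWeight_sub_sq_le_rho (p p' : I) (j : Fin 2) :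
    (√(bernWeight p j) - √(bernWeight p' j)) ^ 2 ≤ rho p p' := by
  unfold rho
  fin_cases j
  · simpa using sq_nonneg _
  · simpa using sq_nonneg _

lemma affinity_bernWeight (p p' : I) :
    ∑ j, √(bernWeight p j) * √(bernWeight p' j) = 1 - rho p p' / 2 := by
  have h1 := Real.sq_sqrt p.2.1
  have h2 := Real.sq_sqrt p'.2.1
  have h3 := Real.sq_sqrt (sub_nonneg.2 p.2.2)
  have h4 := Real.sq_sqrt (sub_nonneg.2 p'.2.2)
  simp only [Fin.sum_univ_two, bernWeight_zero, bernWeight_one, rho]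
  linear_combination (h1 + h2 + h3 + h4) / 2

lemma rho_le_two (p p' : I) : rho p p' ≤ 2 := by
  have h := affinity_bernWeight p p'
  have : 0 ≤ ∑ j, √(bernWeight p j) * √(bernWeight p' j) := by positivity
  linarith

lemma sq_sqrt_sub_sqrt_le_abs_sub {x y : ℝ} (hx : 0 ≤ x) (hy : 0 ≤ y) :
    (√x - √y) ^ 2 ≤ |x - y| := by
  have hx' := Real.sq_sqrt hx
  have hy' := Real.sq_sqrt hy
  have h1 := Real.sqrt_nonneg x
  have h2 := Real.sqrt_nonneg y
  rcases le_total (√x) (√y) with h | h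
  · exact le_trans (by nlinarith) (neg_abs_le _ |> neg_le.1)
  · exact le_trans (by nlinarith) (le_abs_self _)

lemma rho_le_two_mul_abs_sub (p p' : I) : rho p p' ≤ 2 * |(p : ℝ) - p'| := by
  have h1 := sq_sqrt_sub_sqrt_le_abs_sub p.2.1 p'.2.1
  have h2 := sq_sqrt_sub_sqrt_le_abs_sub (sub_nonneg.2 p.2.2) (sub_nonneg.2 p'.2.2)
  have h3 : (1 - (p : ℝ)) - (1 - p') = -(p - p') := by ring
  rw [h3, abs_neg] at h2
  unfold rho
  linarith

/-- If `x ≤ C y`, the excess of `x² / y` over its linearization `2 x - y` at `x = y`, which is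
`(x - y)² / y`, is at most a multiple of the squared Hellinger distance. -/
lemma sq_div_le_of_le_mul {x y C : ℝ} (hx : 0 ≤ x) (hy : 0 ≤ y) (hC : 0 ≤ C) (h : x ≤ C * y) :
    x ^ 2 / y ≤ 2 * x - y + (√C + 1) ^ 2 * (√x - √y) ^ 2 := by
  rcases hy.eq_or_lt with rfl | hy
  · obtain rfl : x = 0 := le_antisymm (by simpa using h) hx
    simp
  · rw [div_le_iff₀ hy]
    have hle : √x ≤ √C * √y := by rw [← Real.sqrt_mul hC]; exact Real.sqrt_le_sqrt h
    have hx' := Real.sq_sqrt hx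
    have hy' := Real.sq_sqrt hy.le
    have h1 := Real.sqrt_nonneg x
    have h2 := Real.sqrt_nonneg y
    have h3 : (√x + √y) ^ 2 ≤ (√C + 1) ^ 2 * y := by
      calc (√x + √y) ^ 2 ≤ (√C * √y + √y) ^ 2 := by gcongr
        _ = (√C + 1) ^ 2 * y := by linear_combination (√C + 1) ^ 2 * hy'
    have h4 : (x - y) ^ 2 = (√x - √y) ^ 2 * (√x + √y) ^ 2 := by
      conv_lhs => rw [← hx', ← hy']
      ring
    nlinarith [mul_le_mul_of_nonneg_left h3 (sq_nonneg (√x - √y))]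

lemma sum_sq_bernWeight_div_le {p p' : I} {C : ℝ} (hC : 0 ≤ C)
    (h : ∀ j, bernWeight p j ≤ C * bernWeight p' j) :
    ∑ j, bernWeight p j ^ 2 / bernWeight p' j ≤ 1 + (√C + 1) ^ 2 * rho p p' := by
  have key := fun j =>
    sq_div_le_of_le_mul (bernWeight_nonneg p j) (bernWeight_nonneg p' j) hC (h j)
  have h0 := key 0
  have h1 := key 1
  rw [Fin.sum_univ_two]
  simp only [bernWeight_zero, bernWeight_one] at h0 h1 ⊢
  unfold rho
  linarith

/-! ### Products of Bernoulli weights -/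

section ProductWeights

variable {α : Type*} [Fintype α] [DecidableEq α]

lemma sum_prod_fin_two_eq (f : α → Fin 2 → ℝ) :
    ∑ x : α → Fin 2, ∏ i, f i (x i) = ∏ i, ∑ j, f i j := by
  rw [Finset.prod_univ_sum, Fintype.piFinset_univ]

omit [DecidableEq α] in
lemma prod_bernWeight_nonneg (p : α → I) (x : α → Fin 2) : 0 ≤ ∏ i, bernWeight (p i) (x i) :=
  Finset.prod_nonneg fun _ _ => bernWeight_nonneg _ _

lemma sum_prod_bernWeight (p : α → I) : ∑ x : α → Fin 2, ∏ i, bernWeight (p i) (x i) = 1 := by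
  rw [sum_prod_fin_two_eq]
  simp

/-- The Hellinger affinity is multiplicative over independent coordinates. -/
lemma affinity_prod_bernWeight (p p' : α → I) :
    ∑ x : α → Fin 2, √(∏ i, bernWeight (p i) (x i)) * √(∏ i, bernWeight (p' i) (x i)) =
      ∏ i, (1 - rho (p i) (p' i) / 2) := by
  simp_rw [← affinity_bernWeight, ← sum_prod_fin_two_eq, Finset.prod_mul_distrib]
  refine Finset.sum_congr rfl fun x _ => ?_
  rw [Real.sqrt_prod _ fun i _ => bernWeight_nonneg _ _,
    Real.sqrt_prod _ fun i _ => bernWeight_nonneg _ _]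

omit [DecidableEq α] in
lemma prod_one_sub_rho_le_exp (p p' : α → I) :
    ∏ i, (1 - rho (p i) (p' i) / 2) ≤ Real.exp (-(∑ i, rho (p i) (p' i)) / 2) := by
  rw [neg_div, Finset.sum_div, ← Finset.sum_neg_distrib, Real.exp_sum]
  refine Finset.prod_le_prod (fun i _ => ?_) fun i _ => Real.one_sub_le_exp_neg _
  linarith [rho_le_two (p i) (p' i)]

lemma one_sub_sum_rho_le_prod (p p' : α → I) :
    1 - (∑ i, rho (p i) (p' i)) / 2 ≤ ∏ i, (1 - rho (p i) (p' i) / 2) := by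
  rw [Finset.sum_div]
  suffices ∀ s : Finset α, 0 ≤ ∏ i ∈ s, (1 - rho (p i) (p' i) / 2) ∧
      ∏ i ∈ s, (1 - rho (p i) (p' i) / 2) ≤ 1 ∧
      1 - ∑ i ∈ s, rho (p i) (p' i) / 2 ≤ ∏ i ∈ s, (1 - rho (p i) (p' i) / 2) from
    (this Finset.univ).2.2
  intro s
  induction s using Finset.induction_on with
  | empty => simp
  | insert i s hi ih =>
    obtain ⟨h0, h1, h2⟩ := ih
    have h3 := rho_nonneg (p i) (p' i)
    have h4 := rho_le_two (p i) (p' i)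
    rw [Finset.prod_insert hi, Finset.sum_insert hi]
    refine ⟨?_, ?_, ?_⟩ <;> nlinarith

lemma sum_sq_prod_bernWeight_div_le {p p' : α → I} {C : ℝ} (hC : 0 ≤ C)
    (h : ∀ i j, bernWeight (p i) j ≤ C * bernWeight (p' i) j) :
    ∑ x : α → Fin 2, (∏ i, bernWeight (p i) (x i)) ^ 2 / ∏ i, bernWeight (p' i) (x i) ≤
      Real.exp ((√C + 1) ^ 2 * ∑ i, rho (p i) (p' i)) := by
  simp_rw [← Finset.prod_pow, ← Finset.prod_div_distrib]
  rw [sum_prod_fin_two_eq fun i j => bernWeight (p i) j ^ 2 / bernWeight (p' i) j,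
    Finset.mul_sum, Real.exp_sum]
  refine Finset.prod_le_prod (fun i _ => Finset.sum_nonneg fun j _ =>
    div_nonneg (sq_nonneg _) (bernWeight_nonneg _ _)) fun i _ => ?_
  refine (sum_sq_bernWeight_div_le hC (h i)).trans ?_
  rw [add_comm]
  exact Real.add_one_le_exp _

end ProductWeights

/-! ### Product laws and their finite-dimensional cylinders -/

section Law

open scoped symmDiff

variable {ι : Type*}

/-- The law on `{0, 1}^ι` under which the coordinates are independent with laws `Be(p i)`. -/
noncomputable def bernProd (p : ι → I) : Measure (ι → Fin 2) :=
  Measure.infinitePi fun i => bernoulliMeasure (1 : Fin 2) 0 (p i)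

instance (p : ι → I) : IsProbabilityMeasure (bernProd p) := by
  unfold bernProd; infer_instance

lemma IsIndicatorVector.vectorLaw_eq {Ω : Type*} [MeasurableSpace Ω] {μ : Measure Ω}
    {X : ι → Ω → Fin 2} {p : ι → I} (h : IsIndicatorVector μ X p) :
    vectorLaw μ X = bernProd p :=
  (h.indep.hasLaw_infinitePi h.hasLaw (measurable_pi_iff.2 h.measurable).aemeasurable).map_eq

open Classical in
lemma bernProd_real_cylinder (p : ι → I) (s : Finset ι) (A : Finset (s → Fin 2)) :
    (bernProd p).real (cylinder s (A : Set (s → Fin 2))) =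
      ∑ x ∈ A, ∏ i : s, bernWeight (p i) (x i) := by
  rw [measureReal_def, bernProd, Measure.infinitePi_cylinder _ A.measurableSet, ← measureReal_def,
    ← sum_measureReal_singleton]
  refine Finset.sum_congr rfl fun x _ => ?_
  rw [measureReal_def, Measure.pi_singleton, ENNReal.toReal_prod]
  exact Finset.prod_congr rfl fun i _ => bernoulliMeasure_real_singleton _ _

/-- A linear comparison between two finite measures extends from finite-dimensional cylinders to
all measurable sets, since cylinders approximate measurable sets in measure. -/
lemma real_le_add_mul_real_of_cylinder {P Q : Measure (ι → Fin 2)} [IsFiniteMeasure P]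
    [IsFiniteMeasure Q] {a b : ℝ} (hb : 0 ≤ b)
    (h : ∀ (s : Finset ι) (A : Finset (s → Fin 2)),
      P.real (cylinder s (A : Set (s → Fin 2))) ≤
        a + b * Q.real (cylinder s (A : Set (s → Fin 2))))
    {A : Set (ι → Fin 2)} (hA : MeasurableSet A) : P.real A ≤ a + b * Q.real A := by
  classical
  refine le_of_forall_pos_le_add fun ε hε => ?_
  have hε' : 0 < ε / (1 + b) := by positivity
  obtain ⟨t, ht, hlt⟩ := (Measure.MeasureDense.of_generateFrom_isSetAlgebra_finite (P + Q)
    isSetAlgebra_measurableCylinders generateFrom_measurableCylinders.symm).approx A hA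
    (by finiteness) _ hε'
  obtain ⟨s, S, -, rfl⟩ := (mem_measurableCylinders t).1 ht
  have hS := h s S.toFinite.toFinset
  rw [Set.Finite.coe_toFinset] at hS
  rw [Measure.add_apply] at hlt
  have hP : P.real (A ∆ cylinder s S) < ε / (1 + b) := by
    rw [measureReal_def, ← ENNReal.lt_ofReal_iff_toReal_lt (measure_ne_top _ _)]
    exact le_self_add.trans_lt hlt
  have hQ : Q.real (A ∆ cylinder s S) < ε / (1 + b) := by
    rw [measureReal_def, ← ENNReal.lt_ofReal_iff_toReal_lt (measure_ne_top _ _)]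
    exact le_add_self.trans_lt hlt
  have h1 : P.real A ≤ P.real (cylinder s S) + P.real (A ∆ cylinder s S) := by
    refine (measureReal_mono ?_).trans (measureReal_union_le _ _)
    intro x hx
    by_cases hx' : x ∈ cylinder s S
    exacts [Or.inl hx', Or.inr (Or.inl ⟨hx, hx'⟩)]
  have h2 : Q.real (cylinder s S) ≤ Q.real A + Q.real (A ∆ cylinder s S) := by
    refine (measureReal_mono ?_).trans (measureReal_union_le _ _)
    intro x hx
    by_cases hx' : x ∈ A
    exacts [Or.inl hx', Or.inr (Or.inr ⟨hx, hx'⟩)]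
  have h3 : ε = ε / (1 + b) + b * (ε / (1 + b)) := by field_simp
  nlinarith

/-! ### Comparison of two product laws -/

lemma rhoSum_comm (p p' : ι → I) : rhoSum p p' = rhoSum p' p :=
  tsum_congr fun i => by rw [rho_comm]

lemma sum_rho_le {p p' : ι → I} {R : ℝ} (hR : 0 ≤ R) (h : rhoSum p p' ≤ ENNReal.ofReal R)
    (s : Finset ι) : ∑ i ∈ s, rho (p i) (p' i) ≤ R := by
  rw [← ENNReal.ofReal_le_ofReal_iff hR,
    ENNReal.ofReal_sum_of_nonneg fun i _ => rho_nonneg (p i) (p' i)]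
  exact (ENNReal.sum_le_tsum s).trans h

lemma rhoSum_le {p p' : ι → I} {R : ℝ}
    (h : ∀ s : Finset ι, ∑ i ∈ s, rho (p i) (p' i) ≤ R) : rhoSum p p' ≤ ENNReal.ofReal R := by
  rw [rhoSum, ENNReal.tsum_eq_iSup_sum]
  refine iSup_le fun s => ?_
  rw [← ENNReal.ofReal_sum_of_nonneg fun i _ => rho_nonneg (p i) (p' i)]
  exact ENNReal.ofReal_le_ofReal (h s)

/-- Total variation of two product laws is at most `2 √(∑ ρ)`. -/
lemma bernProd_real_le_add_sqrt {p p' : ι → I} {R : ℝ} (hR : 0 ≤ R)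
    (h : rhoSum p p' ≤ ENNReal.ofReal R) {A : Set (ι → Fin 2)} (hA : MeasurableSet A) :
    (bernProd p).real A ≤ 2 * √R + (bernProd p').real A := by
  classical
  rw [← one_mul ((bernProd p').real A)]
  refine real_le_add_mul_real_of_cylinder zero_le_one (fun s A => ?_) hA
  rw [bernProd_real_cylinder, bernProd_real_cylinder, one_mul]
  have h1 := sq_sum_sub_sum_le_affinity
    (prod_bernWeight_nonneg fun i : s => p i)
    (prod_bernWeight_nonneg fun i : s => p' i)
    (sum_prod_bernWeight fun i : s => p i) (sum_prod_bernWeight fun i : s => p' i) A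
  rw [affinity_prod_bernWeight] at h1
  have h2 := one_sub_sum_rho_le_prod (fun i : s => p i) fun i => p' i
  have h3 := sum_rho_le hR h s
  rw [← Finset.sum_coe_sort] at h3
  have h4 := Real.abs_le_sqrt (h1.trans (by linarith : _ ≤ 2 ^ 2 * R))
  rw [Real.sqrt_mul (by norm_num), Real.sqrt_sq (by norm_num)] at h4
  linarith [le_abs_self (∑ x ∈ A, ∏ i : s, bernWeight (p i) (x i) -
    ∑ x ∈ A, ∏ i : s, bernWeight (p' i) (x i))]

/-- The likelihood-ratio test on finitely many coordinates separates the two laws up to a total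
error that is exponentially small in the Hellinger sum over these coordinates. -/
lemma exists_test_le_exp_neg_sum_rho (p p' : ι → I) (s : Finset ι) :
    ∃ A : Set (ι → Fin 2), MeasurableSet A ∧
      (bernProd p').real A + (1 - (bernProd p).real A) ≤
        Real.exp (-(∑ i ∈ s, rho (p i) (p' i)) / 2) := by
  classical
  let A : Finset (s → Fin 2) :=
    {x | ∏ i : s, bernWeight (p' i) (x i) ≤ ∏ i : s, bernWeight (p i) (x i)}
  refine ⟨cylinder s (A : Set (s → Fin 2)), A.measurableSet.cylinder s, ?_⟩
  have hcompl := Finset.sum_add_sum_compl A fun x => ∏ i : s, bernWeight (p i) (x i)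
  rw [sum_prod_bernWeight fun i : s => p i] at hcompl
  rw [bernProd_real_cylinder, bernProd_real_cylinder, ← hcompl, add_sub_cancel_left,
    ← Finset.sum_coe_sort s]
  refine (sum_min_le_affinity
    (prod_bernWeight_nonneg fun i : s => p i)
    (prod_bernWeight_nonneg fun i : s => p' i) A
    fun x => by rw [Finset.mem_filter]; simp).trans ?_
  rw [affinity_prod_bernWeight]
  exact prod_one_sub_rho_le_exp _ _

/-- If the coordinatewise likelihood ratios are bounded by `C`, the likelihood ratio of the two
product laws has second moment at most `exp ((√C + 1)² ∑ ρ)`, which gives a quantitative form of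
absolute continuity. -/
lemma bernProd_real_le_of_le_mul {p p' : ι → I} {C R t : ℝ} (hC : 0 ≤ C) (ht : 0 < t) (hR : 0 ≤ R)
    (h : ∀ i j, bernWeight (p i) j ≤ C * bernWeight (p' i) j)
    (hρ : rhoSum p p' ≤ ENNReal.ofReal R) {A : Set (ι → Fin 2)} (hA : MeasurableSet A) :
    (bernProd p).real A ≤
      t * Real.exp ((√C + 1) ^ 2 * R) + t⁻¹ * (bernProd p').real A := by
  classical
  refine real_le_add_mul_real_of_cylinder (inv_nonneg.2 ht.le) (fun s A => ?_) hA
  rw [bernProd_real_cylinder, bernProd_real_cylinder]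
  have h1 := sq_sum_le_sum_mul_sum_sq_div
    (a := fun x : s → Fin 2 => ∏ i : s, bernWeight (p i) (x i))
    (prod_bernWeight_nonneg fun i : s => p' i)
    (fun x hx => by
      obtain ⟨i, -, hi⟩ := Finset.prod_eq_zero_iff.1 hx
      refine Finset.prod_eq_zero (Finset.mem_univ i) (le_antisymm ?_ (bernWeight_nonneg _ _))
      simpa [hi] using h i.1 (x i)) A
  have h2 := sum_sq_prod_bernWeight_div_le hC fun i : s => h i
  have h3 := sum_rho_le hR hρ s
  rw [← Finset.sum_coe_sort] at h3
  have h4 : Real.exp ((√C + 1) ^ 2 * ∑ i : s, rho (p i) (p' i)) ≤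
      Real.exp ((√C + 1) ^ 2 * R) := by gcongr
  have hy : 0 ≤ ∑ x ∈ A, ∏ i : s, bernWeight (p' i) (x i) :=
    Finset.sum_nonneg fun x _ => Finset.prod_nonneg fun i _ => bernWeight_nonneg _ _
  have hM := Real.exp_pos ((√C + 1) ^ 2 * R)
  set M := Real.exp ((√C + 1) ^ 2 * R)
  set y := ∑ x ∈ A, ∏ i : s, bernWeight (p' i) (x i)
  have h5 := h1.trans (mul_le_mul_of_nonneg_left (h2.trans h4) hy)
  refine abs_le_of_sq_le_sq' (h5.trans ?_) (by positivity) |>.2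
  have h6 : (t * M + t⁻¹ * y) ^ 2 = (t * M - t⁻¹ * y) ^ 2 + 4 * (y * M) := by
    field_simp; ring
  nlinarith [sq_nonneg (t * M - t⁻¹ * y), mul_nonneg hy hM.le]

/-! ### Coordinates with a large likelihood ratio -/

lemma tailSum_eq_tsum_indicator (C : ℝ) (p p' : ι → I) :
    tailSum C p p' =
      ∑' i, {i | C * (p' i : ℝ) < p i}.indicator (fun i => ENNReal.ofReal (p i : ℝ)) i :=
  tsum_subtype {i | C * (p' i : ℝ) < p i} fun i => ENNReal.ofReal (p i : ℝ)

lemma four_mul_sq_sqrt_sub_ge {x y C : ℝ} (hx : 0 ≤ x) (hy : 0 ≤ y) (hC : 4 ≤ C)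
    (h : C * y < x) : x ≤ 4 * (√x - √y) ^ 2 := by
  have h1 : 2 * √y ≤ √x := by
    rw [show (2 : ℝ) = √4 by rw [show (4 : ℝ) = 2 ^ 2 by norm_num]; simp,
      ← Real.sqrt_mul (by norm_num)]
    exact Real.sqrt_le_sqrt (by nlinarith)
  nlinarith [Real.sq_sqrt hx, Real.sqrt_nonneg y]

/-- Testing whether some coordinate `i` with `f i > C f' i` takes the value `j`: under the second
law this has small probability when `C` is large, so if it has small probability under the first
law as well, then `∑ f i` over these coordinates is small. -/
lemma tailSum_le_of_forall_real_le {p p' : ι → I} {j : Fin 2} {f f' : ι → I}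
    (hf : ∀ i, (f i : ℝ) = bernWeight (p i) j) (hf' : ∀ i, (f' i : ℝ) = bernWeight (p' i) j)
    {C R δ ε : ℝ} (hC : 4 ≤ C) (hR : 0 ≤ R) (hε : ε < 1) (hδ : 4 * R / C ≤ δ)
    (hρ : rhoSum p p' ≤ ENNReal.ofReal R)
    (h : ∀ A : Set (ι → Fin 2), MeasurableSet A → (bernProd p').real A ≤ δ →
      (bernProd p).real A ≤ ε) :
    tailSum C f f' ≤ ENNReal.ofReal (-Real.log (1 - ε)) := by
  classical
  rw [tailSum, ENNReal.tsum_eq_iSup_sum]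
  refine iSup_le fun s' => ?_
  rw [← ENNReal.ofReal_sum_of_nonneg fun i _ => (f i.1).2.1]
  refine ENNReal.ofReal_le_ofReal ?_
  set s : Finset ι := s'.map (Function.Embedding.subtype _) with hs
  have hsC : ∀ i ∈ s, C * (f' i : ℝ) < f i := by
    intro i hi
    simp only [hs, Finset.mem_map, Function.Embedding.coe_subtype] at hi
    obtain ⟨i, -, rfl⟩ := hi
    exact i.2
  have hsum : ∑ i ∈ s', (f i.1 : ℝ) = ∑ i ∈ s, (f i : ℝ) := by simp [hs]
  rw [hsum]
  have hCpos : 0 < C := by linarith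
  -- `B` is the box on which no coordinate in `s` equals `j`; the test event is its complement.
  set B : Set (ι → Fin 2) := (s : Set ι).pi fun _ => {j}ᶜ with hB
  have hBm : MeasurableSet B := .pi s.countable_toSet fun _ _ => MeasurableSet.of_discrete
  have hBP : ∀ r : ι → I, (bernProd r).real B = ∏ i ∈ s, (1 - bernWeight (r i) j) := by
    intro r
    rw [measureReal_def, bernProd, hB, Measure.infinitePi_pi _ fun _ _ => MeasurableSet.of_discrete,
      ENNReal.toReal_prod]
    refine Finset.prod_congr rfl fun i _ => ?_
    rw [← measureReal_def, probReal_compl_eq_one_sub (measurableSet_singleton j),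
      bernoulliMeasure_real_singleton]
  have hQ : (bernProd p').real Bᶜ ≤ δ := by
    have h1 : Bᶜ ⊆ ⋃ i ∈ s, {x | x i = j} := by
      intro x hx
      simp only [hB, Set.mem_compl_iff, Set.mem_pi, Finset.mem_coe, Set.mem_singleton_iff,
        not_forall, not_not] at hx
      simpa using hx
    have h2 : ∀ i, (bernProd p').real {x | x i = j} = f' i := by
      intro i
      rw [hf', ← bernoulliMeasure_real_singleton,
        ← (measurePreserving_eval_infinitePi
          (fun i => bernoulliMeasure (1 : Fin 2) 0 (p' i)) i).measureReal_preimage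
          (measurableSet_singleton j).nullMeasurableSet]
      rfl
    have h3 : ∑ i ∈ s, (f' i : ℝ) ≤ 4 * R / C := by
      rw [le_div_iff₀ hCpos, Finset.sum_mul]
      calc ∑ i ∈ s, (f' i : ℝ) * C ≤ ∑ i ∈ s, 4 * rho (p i) (p' i) := by
            refine Finset.sum_le_sum fun i hi => ?_
            have h4 := four_mul_sq_sqrt_sub_ge (f i).2.1 (f' i).2.1 hC (hsC i hi)
            have h5 := sqrt_bernWeight_sub_sq_le_rho (p i) (p' i) j
            rw [← hf, ← hf'] at h5
            linarith [hsC i hi]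
        _ ≤ 4 * R := by
            rw [← Finset.mul_sum]
            linarith [sum_rho_le hR hρ s]
    calc (bernProd p').real Bᶜ ≤ (bernProd p').real (⋃ i ∈ s, {x | x i = j}) :=
          measureReal_mono h1 (measure_ne_top _ _)
      _ ≤ ∑ i ∈ s, (bernProd p').real {x | x i = j} := measureReal_biUnion_finset_le _ _
      _ = ∑ i ∈ s, (f' i : ℝ) := Finset.sum_congr rfl fun i _ => h2 i
      _ ≤ δ := h3.trans hδ
  have hP := h _ hBm.compl hQ
  rw [probReal_compl_eq_one_sub hBm, hBP] at hP
  have hexp : ∏ i ∈ s, (1 - bernWeight (p i) j) ≤ Real.exp (-∑ i ∈ s, (f i : ℝ)) := by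
    rw [← Finset.sum_neg_distrib, Real.exp_sum]
    refine Finset.prod_le_prod (fun i _ => sub_nonneg.2 (bernWeight_le_one _ _)) fun i _ => ?_
    rw [hf]
    exact Real.one_sub_le_exp_neg _
  have := (Real.log_le_iff_le_exp (by linarith)).2 (by linarith : 1 - ε ≤ _)
  linarith

open Classical in
/-- The parameters `p`, replaced by `p'` at the coordinates where one of the likelihood ratios
`p i / p' i` and `(1 - p i) / (1 - p' i)` exceeds `C`. -/
noncomputable def truncParam (C : ℝ) (p p' : ι → I) (i : ι) : I :=
  if C * (p' i : ℝ) < p i ∨ C * (σ (p' i) : ℝ) < σ (p i) then p' i else p i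

lemma bernWeight_truncParam_le {C : ℝ} (hC : 1 ≤ C) (p p' : ι → I) (i : ι) (j : Fin 2) :
    bernWeight (truncParam C p p' i) j ≤ C * bernWeight (p' i) j := by
  unfold truncParam
  split_ifs with h
  · nlinarith [bernWeight_nonneg (p' i) j]
  · push Not at h
    fin_cases j
    · simpa using h.2
    · simpa using h.1

lemma rhoSum_truncParam_le (C : ℝ) (p p' : ι → I) :
    rhoSum (truncParam C p p') p' ≤ rhoSum p p' := by
  refine ENNReal.tsum_le_tsum fun i => ENNReal.ofReal_le_ofReal ?_
  unfold truncParam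
  split_ifs
  · simpa [rho] using rho_nonneg (p i) (p' i)
  · rfl

/-- Truncation changes only coordinates of the tail sums, and there `|p i - p' i|` is at most the
larger of the two competing probabilities. -/
lemma rhoSum_self_truncParam_le {C : ℝ} (hC : 1 ≤ C) (p p' : ι → I) :
    rhoSum p (truncParam C p p') ≤
      2 * (tailSum C p p' + tailSum C (fun i => σ (p i)) fun i => σ (p' i)) := by
  rw [tailSum_eq_tsum_indicator, tailSum_eq_tsum_indicator, ← ENNReal.tsum_add,
    ← ENNReal.tsum_mul_left]
  refine ENNReal.tsum_le_tsum fun i => ?_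
  have key := rho_le_two_mul_abs_sub (p i) (p' i)
  have h0 := (p i).2
  have h0' := (p' i).2
  by_cases h1 : C * (p' i : ℝ) < p i
  · have h3 : rho (p i) (truncParam C p p' i) ≤ 2 * p i := by
      rw [truncParam, if_pos (Or.inl h1)]
      have : (p' i : ℝ) ≤ p i := by nlinarith [h0'.1]
      rw [abs_of_nonneg (by linarith)] at key
      linarith [h0'.1]
    rw [Set.indicator_of_mem (by exact h1)]
    calc _ ≤ ENNReal.ofReal (2 * p i) := ENNReal.ofReal_le_ofReal h3
      _ = 2 * ENNReal.ofReal (p i) := by rw [ENNReal.ofReal_mul (by norm_num)]; simp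
      _ ≤ _ := by gcongr; exact le_self_add
  · by_cases h2 : C * (σ (p' i) : ℝ) < σ (p i)
    · have h3 : rho (p i) (truncParam C p p' i) ≤ 2 * σ (p i) := by
        rw [truncParam, if_pos (Or.inr h2)]
        simp only [unitInterval.coe_symm_eq] at h2 ⊢
        have : (p i : ℝ) ≤ p' i := by nlinarith [h0'.2]
        rw [abs_of_nonpos (by linarith)] at key
        linarith [h0'.2]
      rw [Set.indicator_of_mem (s := {i | C * (σ (p' i) : ℝ) < σ (p i)}) (by exact h2)]
      calc _ ≤ ENNReal.ofReal (2 * σ (p i)) := ENNReal.ofReal_le_ofReal h3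
        _ = 2 * ENNReal.ofReal (σ (p i)) := by rw [ENNReal.ofReal_mul (by norm_num)]; simp
        _ ≤ _ := by gcongr; exact le_add_self
    · rw [truncParam, if_neg (by tauto)]
      simp [rho]

end Law

/-! ### Uniform forms of asymptotic equivalence and contiguity -/

section Sequences

variable {𝓧 : ℕ → Type*} [∀ n, MeasurableSpace (𝓧 n)] {P Q : ∀ n, Measure (𝓧 n)}

lemma AsympEquiv.eventually_forall_sub_le (h : AsympEquiv P Q) {ε : ℝ} (hε : 0 < ε) :
    ∀ᶠ n in atTop, ∀ A, MeasurableSet A → (P n).real A - (Q n).real A ≤ ε := by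
  have hex : ∀ n, ∃ A : Set (𝓧 n), MeasurableSet A ∧
      ((∃ B, MeasurableSet B ∧ ε < (P n).real B - (Q n).real B) →
        ε < (P n).real A - (Q n).real A) := by
    intro n
    by_cases hB : ∃ B, MeasurableSet B ∧ ε < (P n).real B - (Q n).real B
    · exact hB.imp fun B hB => ⟨hB.1, fun _ => hB.2⟩
    · exact ⟨∅, .empty, fun h => absurd h hB⟩
  choose A hA hA' using hex
  filter_upwards [(h A hA).eventually (Iic_mem_nhds hε)] with n hn B hB
  by_contra! hlt
  exact (hA' n ⟨B, hB, hlt⟩).not_ge hn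

lemma Contiguous.exists_forall_real_le [∀ n, IsFiniteMeasure (P n)] [∀ n, IsFiniteMeasure (Q n)]
    (h : Contiguous P Q) {ε : ℝ} (hε : 0 < ε) :
    ∃ δ > 0, ∀ᶠ n in atTop, ∀ A, MeasurableSet A → (Q n).real A ≤ δ → (P n).real A ≤ ε := by
  by_contra! hcon
  obtain ⟨φ, hφ, hB⟩ := extraction_forall_of_frequently
    fun k : ℕ => hcon (1 / ((k : ℝ) + 1)) (by positivity)
  choose B hBm hBQ hBP using hB
  -- Off the range of the subsequence `φ`, the test sets are empty.
  have hex : ∀ n, ∃ A : Set (𝓧 n), MeasurableSet A ∧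
      (∀ k, φ k = n → (Q n).real A ≤ 1 / ((k : ℝ) + 1) ∧ ε < (P n).real A) ∧
      ((∀ k, φ k ≠ n) → A = ∅) := by
    intro n
    by_cases hn : ∃ k, φ k = n
    · obtain ⟨k, rfl⟩ := hn
      refine ⟨B k, hBm k, fun l hl => ?_, fun hl => absurd rfl (hl k)⟩
      obtain rfl := hφ.injective hl
      exact ⟨hBQ l, hBP l⟩
    · exact ⟨∅, .empty, fun k hk => absurd ⟨k, hk⟩ hn, fun _ => rfl⟩
  choose A hA hA' hA0 using hex
  have hQ : Tendsto (fun n => Q n (A n)) atTop (𝓝 0) := by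
    rw [← ENNReal.tendsto_toReal_zero_iff fun n => measure_ne_top _ _]
    refine Metric.tendsto_atTop.2 fun η hη => ?_
    obtain ⟨K, hK⟩ := exists_nat_one_div_lt hη
    refine ⟨φ K, fun n hn => ?_⟩
    rw [Real.dist_0_eq_abs, abs_of_nonneg ENNReal.toReal_nonneg]
    by_cases hk : ∃ k, φ k = n
    · obtain ⟨k, rfl⟩ := hk
      have hKk : (K : ℝ) ≤ k := by exact_mod_cast hφ.le_iff_le.1 hn
      refine (hA' _ k rfl).1.trans_lt (lt_of_le_of_lt ?_ hK)
      gcongr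
    · rw [hA0 n fun k hk' => hk ⟨k, hk'⟩]
      simpa using hη
  have hP := h A hA hQ
  rw [← ENNReal.tendsto_toReal_zero_iff fun n => measure_ne_top _ _] at hP
  obtain ⟨k, hk⟩ := (hφ.tendsto_atTop.eventually (hP.eventually (Iio_mem_nhds hε))).exists
  exact lt_asymm hk (hA' _ k rfl).2

lemma contiguous_of_forall_real_le_add_mul [∀ n, IsFiniteMeasure (P n)]
    [∀ n, IsFiniteMeasure (Q n)]
    (h : ∀ ε > 0, ∃ b : ℝ, ∀ᶠ n in atTop, ∀ A, MeasurableSet A →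
      (P n).real A ≤ ε + b * (Q n).real A) : Contiguous P Q := by
  intro A hA hQ
  rw [← ENNReal.tendsto_toReal_zero_iff fun n => measure_ne_top _ _] at hQ ⊢
  refine Metric.tendsto_nhds.2 fun ε hε => ?_
  obtain ⟨b, hb⟩ := h (ε / 2) (half_pos hε)
  have hbQ := hQ.const_mul b
  rw [mul_zero] at hbQ
  filter_upwards [hb, hbQ.eventually (Iio_mem_nhds (half_pos hε))] with n hn hn'
  rw [Real.dist_0_eq_abs, abs_of_nonneg ENNReal.toReal_nonneg]
  have := hn (A n) (hA n)
  simp only [measureReal_def] at this hn'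
  linarith

end Sequences

/-! ### Sequences of product laws -/

section ProductSequences

variable {ι : ℕ → Type*} (p p' : ∀ n, ι n → I)

theorem asympEquiv_bernProd_iff :
    AsympEquiv (fun n => bernProd (p n)) (fun n => bernProd (p' n)) ↔
      Tendsto (fun n => rhoSum (p n) (p' n)) atTop (𝓝 0) := by
  refine ⟨fun h => ENNReal.tendsto_nhds_zero.2 fun η hη => ?_, fun h A hA => ?_⟩
  · obtain ⟨r, -, hr0, hrη⟩ := ENNReal.lt_iff_exists_real_btwn.1 hη
    have hr : 0 < r := ENNReal.ofReal_pos.1 hr0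
    -- `1 - exp (-r / 2)` is the total variation guaranteed by a Hellinger sum of at least `r`.
    have hε : 0 < 1 - Real.exp (-r / 2) := by
      rw [sub_pos, Real.exp_lt_one_iff]; linarith
    filter_upwards [h.eventually_forall_sub_le hε] with n hn
    refine (rhoSum_le fun s => ?_).trans hrη.le
    obtain ⟨A, hA, hAs⟩ := exists_test_le_exp_neg_sum_rho (p n) (p' n) s
    have h1 := hn A hA
    have h2 := Real.exp_le_exp.1 (by linarith :
      Real.exp (-r / 2) ≤ Real.exp (-(∑ i ∈ s, rho (p n i) (p' n i)) / 2))
    linarith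
  · refine Metric.tendsto_nhds.2 fun ε hε => ?_
    have hR : 0 < (ε / 4) ^ 2 := by positivity
    filter_upwards [ENNReal.tendsto_nhds_zero.1 h _ (ENNReal.ofReal_pos.2 hR)] with n hn
    have h1 := bernProd_real_le_add_sqrt hR.le hn (hA n)
    have h2 := bernProd_real_le_add_sqrt hR.le (rhoSum_comm (p n) (p' n) ▸ hn) (hA n)
    rw [Real.sqrt_sq (by positivity)] at h1 h2
    rw [Real.dist_0_eq_abs, abs_lt]
    constructor <;> linarith

variable {p p'}

lemma Contiguous.exists_eventually_rhoSum_le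
    (h : Contiguous (fun n => bernProd (p n)) (fun n => bernProd (p' n))) :
    ∃ K : ℝ≥0, ∀ᶠ n in atTop, rhoSum (p n) (p' n) ≤ K := by
  obtain ⟨δ, hδ, hev⟩ := h.exists_forall_real_le (ε := 1 / 2) (by norm_num)
  set m := min δ (1 / 4) with hm
  have hm0 : 0 < m := lt_min hδ (by norm_num)
  refine ⟨(-2 * Real.log m).toNNReal, ?_⟩
  filter_upwards [hev] with n hn
  refine rhoSum_le fun s => ?_
  by_contra! hlt
  -- The likelihood-ratio test then has total error at most `m`, which contiguity forbids.
  obtain ⟨A, hA, hAs⟩ := exists_test_le_exp_neg_sum_rho (p n) (p' n) s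
  have h1 : Real.exp (-(∑ i ∈ s, rho (p n i) (p' n i)) / 2) ≤ m := by
    rw [← Real.le_log_iff_exp_le hm0]; linarith
  have h2 : (bernProd (p n)).real A ≤ 1 := measureReal_le_one
  have h3 : 0 ≤ (bernProd (p' n)).real A := measureReal_nonneg
  have h4 := hn A hA (by linarith [min_le_left δ (1 / 4)])
  linarith [min_le_right δ (1 / 4)]

lemma Contiguous.tendsto_limsup_tailSum
    (h : Contiguous (fun n => bernProd (p n)) (fun n => bernProd (p' n))) :
    Tendsto (fun C : ℝ => limsup (fun n => tailSum C (p n) (p' n) +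
      tailSum C (fun i => σ (p n i)) (fun i => σ (p' n i))) atTop) atTop (𝓝 0) := by
  obtain ⟨K, hK⟩ := h.exists_eventually_rhoSum_le
  refine ENNReal.tendsto_nhds_zero.2 fun η hη => ?_
  obtain ⟨r, -, hr0, hrη⟩ := ENNReal.lt_iff_exists_real_btwn.1 hη
  have hr : 0 < r := ENNReal.ofReal_pos.1 hr0
  -- With this `ε`, the bound `-log (1 - ε)` of each tail sum is `r / 2`.
  have hε : 0 < 1 - Real.exp (-(r / 2)) := by
    rw [sub_pos, Real.exp_lt_one_iff]; linarith
  have hlog : -Real.log (1 - (1 - Real.exp (-(r / 2)))) = r / 2 := by simp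
  obtain ⟨δ, hδ, hev⟩ := h.exists_forall_real_le hε
  filter_upwards [eventually_ge_atTop 4, eventually_ge_atTop (4 * (K : ℝ) / δ)] with C hC4 hC
  refine limsup_le_of_le (by isBoundedDefault) ?_
  filter_upwards [hK, hev] with n hnK hn
  have hρ : rhoSum (p n) (p' n) ≤ ENNReal.ofReal K := by simpa using hnK
  have hCδ : 4 * (K : ℝ) / C ≤ δ := by
    rw [div_le_iff₀ hδ] at hC
    rw [div_le_iff₀ (by linarith)]
    linarith
  have hlt : 1 - Real.exp (-(r / 2)) < 1 := by linarith [Real.exp_pos (-(r / 2))]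
  have h1 := tailSum_le_of_forall_real_le (j := 1) (f := p n) (f' := p' n) (fun i => by simp)
    (fun i => by simp) hC4 K.2 hlt hCδ hρ hn
  have h0 := tailSum_le_of_forall_real_le (j := 0) (f := fun i => σ (p n i))
    (f' := fun i => σ (p' n i)) (fun i => by simp) (fun i => by simp) hC4 K.2 hlt hCδ hρ hn
  rw [hlog] at h0 h1
  calc _ ≤ ENNReal.ofReal (r / 2) + ENNReal.ofReal (r / 2) := add_le_add h1 h0
    _ = ENNReal.ofReal r := by
        rw [← ENNReal.ofReal_add (by positivity) (by positivity), add_halves]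
    _ ≤ η := hrη.le

lemma contiguous_bernProd_of_tendsto
    (hK : ∃ K : ℝ≥0, ∀ᶠ n in atTop, rhoSum (p n) (p' n) ≤ K)
    (hT : Tendsto (fun C : ℝ => limsup (fun n => tailSum C (p n) (p' n) +
      tailSum C (fun i => σ (p n i)) (fun i => σ (p' n i))) atTop) atTop (𝓝 0)) :
    Contiguous (fun n => bernProd (p n)) (fun n => bernProd (p' n)) := by
  obtain ⟨K, hK⟩ := hK
  refine contiguous_of_forall_real_le_add_mul fun ε hε => ?_
  -- A tail sum of at most `r` makes the truncation cost at most `2 √(2 r) = ε / 2`.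
  set r := (ε / 4) ^ 2 / 2 with hr
  have hr0 : 0 < r := by positivity
  obtain ⟨C, hC, hC1⟩ := ((hT.eventually (Iio_mem_nhds (ENNReal.ofReal_pos.2 hr0))).and
    (eventually_ge_atTop 1)).exists
  set M := Real.exp ((√C + 1) ^ 2 * K) with hM
  have hMpos : 0 < M := Real.exp_pos _
  have ht : 0 < ε / (2 * M) := by positivity
  refine ⟨(ε / (2 * M))⁻¹, ?_⟩
  filter_upwards [hK, eventually_lt_of_limsup_lt hC] with n hnK hn A hA
  have h1 : rhoSum (p n) (truncParam C (p n) (p' n)) ≤ ENNReal.ofReal ((ε / 4) ^ 2) := by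
    calc _ ≤ 2 * ENNReal.ofReal r := (rhoSum_self_truncParam_le hC1 _ _).trans (by gcongr)
      _ = ENNReal.ofReal (2 * r) := by rw [ENNReal.ofReal_mul (by norm_num)]; simp
      _ = _ := by rw [hr]; congr 1; ring
  have h2 : rhoSum (truncParam C (p n) (p' n)) (p' n) ≤ ENNReal.ofReal K :=
    (rhoSum_truncParam_le C _ _).trans (by simpa using hnK)
  have h3 := bernProd_real_le_add_sqrt (by positivity) h1 hA
  have h4 := bernProd_real_le_of_le_mul (by linarith) ht K.2
    (bernWeight_truncParam_le hC1 (p n) (p' n)) h2 hA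
  rw [Real.sqrt_sq (by positivity)] at h3
  have h5 : ε / (2 * M) * M = ε / 2 := by field_simp
  change _ ≤ ε / (2 * M) * M + _ at h4
  linarith

end ProductSequences

theorem theorem1 (N : ℕ → ℕ∞) (hN : ∀ n, 1 ≤ N n)
    {Ω Ω' : ℕ → Type*} [∀ n, MeasurableSpace (Ω n)] [∀ n, MeasurableSpace (Ω' n)]
    (μ : ∀ n, Measure (Ω n)) (μ' : ∀ n, Measure (Ω' n))
    [∀ n, IsProbabilityMeasure (μ n)] [∀ n, IsProbabilityMeasure (μ' n)]
    (p p' : ∀ n, Idx (N n) → I)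
    (X : ∀ n, Idx (N n) → Ω n → Fin 2) (X' : ∀ n, Idx (N n) → Ω' n → Fin 2)
    (hX : ∀ n, IsIndicatorVector (μ n) (X n) (p n))
    (hX' : ∀ n, IsIndicatorVector (μ' n) (X' n) (p' n)) :
    (AsympEquiv (fun n => vectorLaw (μ n) (X n)) (fun n => vectorLaw (μ' n) (X' n)) ↔
      Tendsto (fun n => rhoSum (p n) (p' n)) atTop (𝓝 0)) ∧
    (Contiguous (fun n => vectorLaw (μ n) (X n)) (fun n => vectorLaw (μ' n) (X' n)) ↔
      (∃ K : ℝ≥0, ∀ᶠ n in atTop, rhoSum (p n) (p' n) ≤ K) ∧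
      Tendsto
        (fun C : ℝ => limsup (fun n => tailSum C (p n) (p' n) +
          tailSum C (fun i => unitInterval.symm (p n i)) (fun i => unitInterval.symm (p' n i)))
          atTop)
        atTop (𝓝 0)) := by
  have h := fun n => (hX n).vectorLaw_eq
  have h' := fun n => (hX' n).vectorLaw_eq
  simp only [h, h']
  exact ⟨asympEquiv_bernProd_iff p p',
    fun hc => ⟨hc.exists_eventually_rhoSum_le, hc.tendsto_limsup_tailSum⟩,
    fun hc => contiguous_bernProd_of_tendsto hc.1 hc.2⟩
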